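/- Let $M$ be a non-empty smooth manifold of dimension $m$ with a Riemannian metric $g$ and Levi-Civita connection $\nabla$. An almost contact metric structure $(\varphi,\eta,\xi,g)$ on $M$ consists of a smooth field $\varphi$ of endomorphisms of $TM$, a smooth $1$-form $\eta$ and a smooth vector field $\xi$ such that $$\varphi^2X=-X+\eta(X)\xi,\quad \eta(\xi)=1,\quad \eta\circ\varphi=0,\quad \varphi\xi=0,\quad g(\varphi X,\varphi Y)=g(X,Y)-\eta(X)\eta(Y)$$ for all vector fields $X,Y$; it is a Kenmotsu structure if moreover $$(\nabla_X\varphi)Y=g(\varphi X,Y)\xi-\eta(Y)\varphi X$$ for all smooth vector fields $X,Y$. Suppose that $M$ is a $3$-Kenmotsu manifold, that is, $M$ carries three Kenmotsu structures $(\varphi_\alpha,\eta,\xi,g)$, $\alpha=1,2,3$, with the same $\eta,\xi,g$, such that $\varphi_k=\varphi_i\circ\varphi_j$ for every even permutation $(i,j,k)$ of $(1,2,3)$. Then $m=4n+1$ for some integer $n\ge 0$, and the structure group of the tangent bundle of $M$ reduces to $Sp(n)\times I$: the frame bundle of $M$ has a smooth principal subbundle with structure group $$Sp(n)\times I=\left\{\begin{pmatrix}A&0\\0&1\end{pmatrix}: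 A\in Sp(n)\right\}\subset GL(4n+1,\mathbb R),$$ where $Sp(n)$, the group of quaternionic $n\times n$ matrices $A$ with $A^*A=AA^*=1$, is regarded as a group of real $4n\times4n$ matrices through its action on $\mathbb H^n=\mathbb R^{4n}$. -/

import Mathlib

open Bundle Manifold
open scoped ContDiff Matrix Quaternion

noncomputable section

/-! ### The group `Sp(n) × I` inside `GL(4n + 1, ℝ)` -/

/-- The basis `1, i, j, k` of the quaternions over `ℝ`. -/
def quaternionBasis : Module.Basis (Fin 4) ℝ ℍ[ℝ] :=
  QuaternionAlgebra.basisOneIJK (-1 : ℝ) 0 (-1)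

/-- An `n × n` quaternionic matrix `A` as a real `4n × 4n` matrix: the matrix of the real linear map
`v ↦ A v` of `ℍⁿ` in the real basis `(e_a, e_a i, e_a j, e_a k)`, `a = 1, …, n`. -/
def realification (n : ℕ) :
    Matrix (Fin n) (Fin n) ℍ[ℝ] →ₐ[ℝ] Matrix (Fin n × Fin 4) (Fin n × Fin 4) ℝ :=
  (Matrix.compAlgEquiv (Fin n) (Fin 4) ℝ ℝ).toAlgHom.comp
    (Algebra.leftMulMatrix quaternionBasis).mapMatrix

/-- `A ↦ diag(A, 1)`. -/
def addTrivialBlock (κ : Type*) [Fintype κ] [DecidableEq κ] :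
    Matrix κ κ ℝ →* Matrix (κ ⊕ Unit) (κ ⊕ Unit) ℝ where
  toFun A := Matrix.fromBlocks A 0 0 1
  map_one' := Matrix.fromBlocks_one
  map_mul' A B := by simp [Matrix.fromBlocks_multiply]

/-- The index set of a frame of `ℝ^(4n+1) = ℍⁿ ⊕ ℝ`. -/
abbrev FrameIndex (n : ℕ) : Type := (Fin n × Fin 4) ⊕ Unit

/-- The compact symplectic group `Sp(n)`: the quaternionic `n × n` matrices `A` with
`A* A = A A* = 1`. -/
abbrev CompactSp (n : ℕ) : Submonoid (Matrix (Fin n) (Fin n) ℍ[ℝ]) :=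
  unitary (Matrix (Fin n) (Fin n) ℍ[ℝ])

/-- The homomorphism `Sp(n) → GL(4n + 1, ℝ)`, `A ↦ diag(A, 1)`. -/
def spTimesOneHom (n : ℕ) : CompactSp n →* GL (FrameIndex n) ℝ :=
  (Units.map ((addTrivialBlock (Fin n × Fin 4)).comp (realification n : _ →* _))).comp
    Unitary.toUnits

/-- `Sp(n) × I` as a subgroup of `GL(4n + 1, ℝ)`: the block matrices `diag(A, 1)`, `A ∈ Sp(n)`. -/
def spTimesOne (n : ℕ) : Subgroup (GL (FrameIndex n) ℝ) :=
  (spTimesOneHom n).range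

section Manifolds

variable (m : ℕ) (M : Type*) [TopologicalSpace M] [ChartedSpace (EuclideanSpace ℝ (Fin m)) M]
  [IsManifold (𝓡 m) ∞ M]

/-! ### Reductions of the structure group of the tangent bundle -/

/-- A reduction of the structure group of `TM` to a (closed) subgroup `G` of `GL(ι, ℝ)`: a
principal `G`-subbundle of the frame bundle of `M`. At each point `p` it consists of a set of
frames of `T_p M` that is an orbit of the right action `(b · A)_j = ∑ i, A i j • b i` of `G`
on frames, and near each point there is a smooth local frame of `TM` with values in it. -/
structure StructureGroupReduction {ι : Type*} [Fintype ι] [DecidableEq ι]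
    (G : Subgroup (GL ι ℝ)) where
  frames : (p : M) → Set (Module.Basis ι ℝ (TangentSpace (𝓡 m) p))
  mem_frames_iff : ∀ (p : M), ∀ b ∈ frames p, ∀ b' : Module.Basis ι ℝ (TangentSpace (𝓡 m) p),
    b' ∈ frames p ↔ ∃ A ∈ G, ∀ j, b' j = ∑ i, (A : Matrix ι ι ℝ) i j • b i
  exists_localFrame : ∀ p : M, ∃ (u : Set M) (s : ι → (x : M) → TangentSpace (𝓡 m) x)
    (hs : IsLocalFrameOn (𝓡 m) (EuclideanSpace ℝ (Fin m)) ∞ s u),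
    IsOpen u ∧ p ∈ u ∧ ∀ x (hx : x ∈ u), hs.toBasisAt hx ∈ frames x

/-! ### Kenmotsu structures -/

variable {m M}

/-- Smooth vector fields. -/
def IsSmoothVectorField (X : (p : M) → TangentSpace (𝓡 m) p) : Prop :=
  ContMDiff (𝓡 m) (𝓡 m).tangent ∞
    (fun p ↦ (⟨p, X p⟩ : TangentBundle (𝓡 m) M))

variable [RiemannianBundle (fun p : M ↦ TangentSpace (𝓡 m) p)]
  [IsContMDiffRiemannianBundle (𝓡 m) ∞ (EuclideanSpace ℝ (Fin m))
    (fun p : M ↦ TangentSpace (𝓡 m) p)]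

/-- An almost contact metric structure `(φ, η, ξ, g)`, where `g` is the Riemannian metric that
`TM` carries: `φ` is a smooth field of endomorphisms of `TM`, `ξ` a smooth vector field and `η` a
smooth `1`-form. -/
structure IsAlmostContactMetric
    (φ : (p : M) → TangentSpace (𝓡 m) p →L[ℝ] TangentSpace (𝓡 m) p)
    (η : (p : M) → TangentSpace (𝓡 m) p →L[ℝ] ℝ)
    (ξ : (p : M) → TangentSpace (𝓡 m) p) : Prop where
  smooth_phi : ContMDiff (𝓡 m)
    ((𝓡 m).prod 𝓘(ℝ, EuclideanSpace ℝ (Fin m) →L[ℝ] EuclideanSpace ℝ (Fin m))) ∞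
    (fun p ↦ TotalSpace.mk' (EuclideanSpace ℝ (Fin m) →L[ℝ] EuclideanSpace ℝ (Fin m))
      (E := fun p : M ↦ TangentSpace (𝓡 m) p →L[ℝ] TangentSpace (𝓡 m) p) p (φ p))
  smooth_eta : ContMDiff (𝓡 m) ((𝓡 m).prod 𝓘(ℝ, EuclideanSpace ℝ (Fin m) →L[ℝ] ℝ)) ∞
    (fun p ↦ TotalSpace.mk' (EuclideanSpace ℝ (Fin m) →L[ℝ] ℝ)
      (E := fun p : M ↦ TangentSpace (𝓡 m) p →L[ℝ] ℝ) p (η p))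
  smooth_xi : IsSmoothVectorField ξ
  phi_phi : ∀ p (v : TangentSpace (𝓡 m) p), φ p (φ p v) = -v + η p v • ξ p
  eta_xi : ∀ p, η p (ξ p) = 1
  eta_phi : ∀ p (v : TangentSpace (𝓡 m) p), η p (φ p v) = 0
  phi_xi : ∀ p, φ p (ξ p) = 0
  inner_phi_phi : ∀ p (v w : TangentSpace (𝓡 m) p),
    inner ℝ (φ p v) (φ p w) = inner ℝ v w - η p v * η p w

/-- `∇` is the Levi-Civita connection of `M`: it is torsion free and compatible with the metric. -/
def IsLeviCivita
    (nabla : CovariantDerivative (𝓡 m) (EuclideanSpace ℝ (Fin m))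
      (fun p : M ↦ TangentSpace (𝓡 m) p)) : Prop :=
  haveI : IsContMDiffRiemannianBundle (𝓡 m) 1 (EuclideanSpace ℝ (Fin m))
      (fun p : M ↦ TangentSpace (𝓡 m) p) := .of_le (n := ∞) (by exact_mod_cast le_top)
  nabla.torsion = 0 ∧ nabla.IsMetricCompatible

/-- A Kenmotsu structure: an almost contact metric structure such that
`(∇_X φ) Y = g(φ X, Y) ξ - η(Y) φ X` for all smooth vector fields `X`, `Y`, where
`(∇_X φ) Y = ∇_X (φ Y) - φ (∇_X Y)` and `∇` is the Levi-Civita connection.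
In the code `nabla Y p (X p)` is `∇_X Y` at `p`. -/
structure IsKenmotsu
    (φ : (p : M) → TangentSpace (𝓡 m) p →L[ℝ] TangentSpace (𝓡 m) p)
    (η : (p : M) → TangentSpace (𝓡 m) p →L[ℝ] ℝ)
    (ξ : (p : M) → TangentSpace (𝓡 m) p) : Prop extends IsAlmostContactMetric φ η ξ where
  nabla_phi : ∀ nabla : CovariantDerivative (𝓡 m) (EuclideanSpace ℝ (Fin m))
      (fun p : M ↦ TangentSpace (𝓡 m) p), IsLeviCivita nabla →
    ∀ X Y : (p : M) → TangentSpace (𝓡 m) p, IsSmoothVectorField X → IsSmoothVectorField Y →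
    ∀ p, nabla (fun q ↦ φ q (Y q)) p (X p) - φ p (nabla Y p (X p)) =
      (inner ℝ (φ p (X p)) (Y p) : ℝ) • ξ p - η p (Y p) • φ p (X p)

/-- A `3`-Kenmotsu structure: three Kenmotsu structures `(φ_α, η, ξ, g)` with
`φ_k = φ_i ∘ φ_j` for every even permutation `(i, j, k)` of the three indices. -/
structure IsThreeKenmotsu
    (φ : Fin 3 → (p : M) → TangentSpace (𝓡 m) p →L[ℝ] TangentSpace (𝓡 m) p)
    (η : (p : M) → TangentSpace (𝓡 m) p →L[ℝ] ℝ)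
    (ξ : (p : M) → TangentSpace (𝓡 m) p) : Prop where
  kenmotsu : ∀ α, IsKenmotsu (φ α) η ξ
  phi_comp : ∀ σ : Equiv.Perm (Fin 3), Equiv.Perm.sign σ = 1 →
    ∀ p (v : TangentSpace (𝓡 m) p), φ (σ 2) p v = φ (σ 0) p (φ (σ 1) p v)

end Manifolds

end

/-!
Write `D = ker η`, the orthogonal complement of `ξ`. Each `φ_α` is skew-symmetric, kills `ξ` and
squares to `-1` on `D`, and the relations `φ_k = φ_i ∘ φ_j` then give `φ_j ∘ φ_i = -φ_k`. Thus every
`D_p` is a right `ℍ`-module on which the quaternion units act orthogonally. The covariant derivative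
plays no role: the reduction exists for any three such almost contact metric structures.

The subbundle consists of the adapted frames: the orthonormal frames of the form
`(e_a, e_a i, e_a j, e_a k, ξ)`. A change of adapted frame is `diag(B, 1)` with `B` orthogonal and
commuting with the right action of `ℍ`, that is, with `B` the real form of a quaternionic matrix `Q`
with `Q* Q = 1`; this is `IsContactTriple.isAdaptedFrame_iff`.

Smooth local adapted frames come from a quaternionic Gram-Schmidt process,
`IsThreeKenmotsu.exists_smooth_quaternionFrame`: the orthogonal complement of an orthonormal family
`(e_a, e_a i, e_a j, e_a k, ξ)` is stable under `ℍ`, so a unit field `e` in this complement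
adds the four orthonormal fields `e, e i, e j, e k`. Such a step is possible as long as the family
does not span the tangent space, so the process ends with `4 n + 1 = m` vectors.
-/

/-! ### The linear algebra of one tangent space -/

section LinearAlgebra

variable {V : Type*} [NormedAddCommGroup V] [InnerProductSpace ℝ V]

/-- The pointwise content of a `3`-Kenmotsu structure: three almost contact metric structures
`(φ_α, η, ξ)` on a Euclidean vector space, with `φ_k = φ_i ∘ φ_j` for `(i, j, k)` cyclic. -/
structure IsContactTriple (φ : Fin 3 → V →L[ℝ] V) (η : V →L[ℝ] ℝ) (ξ : V) : Prop where
  phi_phi : ∀ α v, φ α (φ α v) = -v + η v • ξ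
  eta_xi : η ξ = 1
  eta_phi : ∀ α v, η (φ α v) = 0
  phi_xi : ∀ α, φ α ξ = 0
  inner_phi_phi : ∀ α v w, inner ℝ (φ α v) (φ α w) = inner ℝ v w - η v * η w
  phi_one_two : ∀ v, φ 1 (φ 2 v) = φ 0 v
  phi_two_zero : ∀ v, φ 2 (φ 0 v) = φ 1 v
  phi_zero_one : ∀ v, φ 0 (φ 1 v) = φ 2 v

/-- The operators by which the basis `1, i, j, k` of `ℍ` acts on the right. Since `i * j = k`, right
multiplication by `k` is right multiplication by `i` followed by that by `j`; as `φ 2 = φ 0 ∘ φ 1`,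
`i` has to act by `φ 1` and `j` by `φ 0`. -/
def quaternionUnitAction (φ : Fin 3 → V →L[ℝ] V) : Fin 4 → V →L[ℝ] V :=
  ![ContinuousLinearMap.id ℝ V, φ 1, φ 0, φ 2]

/-- The vectors `e_a, e_a i, e_a j, e_a k`, `a = 1, …, k`, followed by `ξ`. -/
def quaternionFrame (φ : Fin 3 → V →L[ℝ] V) (ξ : V) {k : ℕ} (e : Fin k → V) : FrameIndex k → V :=
  Sum.elim (fun x ↦ quaternionUnitAction φ x.2 (e x.1)) fun _ ↦ ξ

/-- An orthonormal family of the form `(e_a, e_a i, e_a j, e_a k, ξ)`. -/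
def IsAdaptedFrame (φ : Fin 3 → V →L[ℝ] V) (ξ : V) {k : ℕ} (f : FrameIndex k → V) : Prop :=
  Orthonormal ℝ f ∧ f = quaternionFrame φ ξ fun a ↦ f (Sum.inl (a, 0))

@[simp]
lemma quaternionFrame_inl (φ : Fin 3 → V →L[ℝ] V) (ξ : V) {k : ℕ} (e : Fin k → V)
    (a : Fin k) (s : Fin 4) :
    quaternionFrame φ ξ e (Sum.inl (a, s)) = quaternionUnitAction φ s (e a) := rfl

@[simp]
lemma quaternionFrame_inr (φ : Fin 3 → V →L[ℝ] V) (ξ : V) {k : ℕ} (e : Fin k → V) (t : Unit) :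
    quaternionFrame φ ξ e (Sum.inr t) = ξ := rfl

@[simp]
lemma quaternionUnitAction_zero (φ : Fin 3 → V →L[ℝ] V) (v : V) :
    quaternionUnitAction φ 0 v = v := rfl

lemma isAdaptedFrame_quaternionFrame {φ : Fin 3 → V →L[ℝ] V} {ξ : V} {k : ℕ} {e : Fin k → V}
    (he : Orthonormal ℝ (quaternionFrame φ ξ e)) : IsAdaptedFrame φ ξ (quaternionFrame φ ξ e) :=
  ⟨he, rfl⟩

namespace IsContactTriple

variable {φ : Fin 3 → V →L[ℝ] V} {η : V →L[ℝ] ℝ} {ξ : V} (h : IsContactTriple φ η ξ)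
include h

lemma inner_xi (v : V) : inner ℝ v ξ = η v := by
  have := h.inner_phi_phi 0 v ξ
  simp only [h.phi_xi, inner_zero_right, h.eta_xi] at this
  linarith

lemma inner_phi_left (α : Fin 3) (v w : V) : inner ℝ (φ α v) w = -inner ℝ v (φ α w) := by
  have := h.inner_phi_phi α v (φ α w)
  simp only [h.phi_phi, inner_add_right, inner_neg_right, inner_smul_right, h.inner_xi,
    h.eta_phi] at this
  linarith

lemma phi_one_zero (v : V) : φ 1 (φ 0 v) = -φ 2 v := by
  rw [← h.phi_one_two, h.phi_phi, h.eta_phi, zero_smul, add_zero]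

lemma phi_two_one (v : V) : φ 2 (φ 1 v) = -φ 0 v := by
  rw [← h.phi_two_zero, h.phi_phi, h.eta_phi, zero_smul, add_zero]

lemma phi_zero_two (v : V) : φ 0 (φ 2 v) = -φ 1 v := by
  rw [← h.phi_zero_one, h.phi_phi, h.eta_phi, zero_smul, add_zero]

lemma inner_phi_self (α : Fin 3) (v : V) : inner ℝ v (φ α v) = 0 := by
  have := h.inner_phi_left α v v
  rw [real_inner_comm] at this
  linarith

lemma eta_quaternionUnitAction {v : V} (hv : η v = 0) (s : Fin 4) :
    η (quaternionUnitAction φ s v) = 0 := by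
  fin_cases s <;> simp [quaternionUnitAction, hv, h.eta_phi]

/-- Right multiplication by unit quaternions is orthogonal, so inner products of right multiples of
`v` and `w` by `1, i, j, k` are, up to sign, inner products of `v` with right multiples of `w`. -/
lemma inner_quaternionUnitAction_eq_zero {v w : V} (hw : η w = 0)
    (hvw : ∀ s, inner ℝ v (quaternionUnitAction φ s w) = 0) (s t : Fin 4) :
    inner ℝ (quaternionUnitAction φ s v) (quaternionUnitAction φ t w) = 0 := by
  have h0 := hvw 0
  have h1 := hvw 1
  have h2 := hvw 2
  have h3 := hvw 3
  simp only [quaternionUnitAction, Matrix.cons_val, ContinuousLinearMap.id_apply] at h0 h1 h2 h3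
  fin_cases s <;> fin_cases t <;>
    simp [quaternionUnitAction, h.inner_phi_left, h.phi_phi, h.phi_one_two, h.phi_two_zero,
      h.phi_zero_one, h.phi_one_zero, h.phi_two_one, h.phi_zero_two, hw, h0, h1, h2, h3]

lemma inner_quaternionUnitAction_self {v : V} (hv : η v = 0) (hv1 : inner ℝ v v = (1 : ℝ))
    (s t : Fin 4) :
    inner ℝ (quaternionUnitAction φ s v) (quaternionUnitAction φ t v) =
      if s = t then (1 : ℝ) else 0 := by
  fin_cases s <;> fin_cases t <;>
    simp [quaternionUnitAction, h.inner_phi_left, h.phi_phi, h.phi_one_two, h.phi_two_zero,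
      h.phi_zero_one, h.phi_one_zero, h.phi_two_one, h.phi_zero_two, hv, hv1, h.inner_phi_self,
      -inner_self_eq_norm_sq_to_K]

lemma inner_xi_quaternionUnitAction {v : V} (hv : η v = 0) (s : Fin 4) :
    inner ℝ ξ (quaternionUnitAction φ s v) = (0 : ℝ) := by
  rw [real_inner_comm, h.inner_xi, h.eta_quaternionUnitAction hv]

lemma orthonormal_quaternionFrame {k : ℕ} {e : Fin k → V} (he : ∀ a, η (e a) = 0)
    (he1 : ∀ a, inner ℝ (e a) (e a) = (1 : ℝ))
    (hec : ∀ a c, a ≠ c → ∀ s, inner ℝ (e a) (quaternionUnitAction φ s (e c)) = (0 : ℝ)) :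
    Orthonormal ℝ (quaternionFrame φ ξ e) := by
  rw [orthonormal_iff_ite]
  rintro (⟨a, s⟩ | -) (⟨c, t⟩ | -)
  · by_cases hac : a = c
    · subst hac
      simp [h.inner_quaternionUnitAction_self (he a) (he1 a)]
    · simp [hac, h.inner_quaternionUnitAction_eq_zero (he c) (hec a c hac)]
  · simp [h.inner_xi, h.eta_quaternionUnitAction (he a)]
  · simp [h.inner_xi_quaternionUnitAction (he c)]
  · simp only [quaternionFrame_inr, h.inner_xi, h.eta_xi, if_true]

lemma eta_eq_zero_of_orthonormal {k : ℕ} {e : Fin k → V}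
    (he : Orthonormal ℝ (quaternionFrame φ ξ e)) (a : Fin k) : η (e a) = 0 := by
  rw [← h.inner_xi]
  exact he.2 (i := Sum.inl (a, 0)) (j := Sum.inr ()) (by simp)

/-- A unit vector orthogonal to a quaternionic orthonormal family extends it: the orthogonal
complement of the family is stable under the right action of `ℍ`. -/
lemma orthonormal_quaternionFrame_cons {k : ℕ} {e : Fin k → V}
    (he : Orthonormal ℝ (quaternionFrame φ ξ e)) {v : V} (hv1 : inner ℝ v v = (1 : ℝ))
    (hv : ∀ i, inner ℝ (quaternionFrame φ ξ e i) v = (0 : ℝ)) :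
    Orthonormal ℝ (quaternionFrame φ ξ (Fin.cons v e : Fin (k + 1) → V)) := by
  have hηe := h.eta_eq_zero_of_orthonormal he
  have hηv : η v = 0 := by
    rw [← h.inner_xi, real_inner_comm]
    exact hv (Sum.inr ())
  have hve (c : Fin k) (s : Fin 4) : inner ℝ v (quaternionUnitAction φ s (e c)) = (0 : ℝ) := by
    rw [real_inner_comm]
    exact hv (Sum.inl (c, s))
  refine h.orthonormal_quaternionFrame ?_ ?_ ?_
  · exact Fin.cases hηv hηe
  · refine Fin.cases hv1 fun a ↦ ?_
    exact (orthonormal_iff_ite.1 he (Sum.inl (a, 0)) (Sum.inl (a, 0))).trans (if_pos rfl)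
  · refine Fin.cases (Fin.cases (by simp) fun c _ s ↦ hve c s) fun a ↦
      Fin.cases (fun _ s ↦ ?_) fun c hac s ↦ ?_
    · -- `⟪e_a, v q⟫ = ± ⟪e_a q, v⟫`
      have := h.inner_quaternionUnitAction_eq_zero (hηe a) (hve a) s 0
      simpa [real_inner_comm] using this
    · have hac' : a ≠ c := fun H ↦ hac (by rw [H])
      exact he.2 (i := Sum.inl (a, 0)) (j := Sum.inl (c, s)) (by simp [hac'])

end IsContactTriple

lemma Orthonormal.exists_ne_zero_forall_inner_eq_zero {ι : Type*} [Fintype ι]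
    [FiniteDimensional ℝ V] {f : ι → V} (hf : Orthonormal ℝ f)
    (hlt : Fintype.card ι < Module.finrank ℝ V) :
    ∃ v : V, v ≠ 0 ∧ ∀ i, inner ℝ (f i) v = (0 : ℝ) := by
  have hspan : Submodule.span ℝ (Set.range f) ≠ ⊤ := by
    intro H
    have := finrank_span_eq_card hf.linearIndependent
    rw [H, finrank_top] at this
    omega
  obtain ⟨v, hv, hv0⟩ := Submodule.exists_mem_ne_zero_of_ne_bot
    (mt (Submodule.orthogonal_eq_bot_iff).1 hspan)
  exact ⟨v, hv0, fun i ↦ hv _ (Submodule.subset_span ⟨i, rfl⟩)⟩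

lemma Orthonormal.inner_sub_sum_eq_zero {ι : Type*} [Fintype ι] {f : ι → V} (hf : Orthonormal ℝ f)
    (v : V) (i : ι) :
    inner ℝ (f i) (v - ∑ j, (inner ℝ (f j) v : ℝ) • f j) = (0 : ℝ) := by
  rw [inner_sub_right, hf.inner_right_fintype, sub_self]

/-! ### Change of adapted frame -/

lemma quaternionBasis_repr (q : ℍ[ℝ]) :
    ⇑(quaternionBasis.repr q) = ![q.re, q.imI, q.imJ, q.imK] := rfl

lemma coe_quaternionBasis :
    ⇑quaternionBasis = ![⟨1, 0, 0, 0⟩, ⟨0, 1, 0, 0⟩, ⟨0, 0, 1, 0⟩, ⟨0, 0, 0, 1⟩] := by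
  funext s
  rw [Module.Basis.apply_eq_iff]
  ext r
  rw [quaternionBasis_repr]
  fin_cases s <;> fin_cases r <;> simp

lemma leftMulMatrix_quaternionBasis (q : ℍ[ℝ]) :
    Algebra.leftMulMatrix quaternionBasis q =
      !![q.re, -q.imI, -q.imJ, -q.imK;
         q.imI, q.re, -q.imK, q.imJ;
         q.imJ, q.imK, q.re, -q.imI;
         q.imK, -q.imJ, q.imI, q.re] := by
  ext r s
  rw [Algebra.leftMulMatrix_eq_repr_mul]
  change quaternionBasis.repr (q * quaternionBasis s : ℍ[ℝ]) r = _
  rw [quaternionBasis_repr, Quaternion.re_mul, Quaternion.imI_mul, Quaternion.imJ_mul,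
    Quaternion.imK_mul, coe_quaternionBasis]
  fin_cases r <;> fin_cases s <;> simp

lemma realification_apply {n : ℕ} (Q : Matrix (Fin n) (Fin n) ℍ[ℝ]) (a c : Fin n) (r s : Fin 4) :
    realification n Q (a, r) (c, s) = Algebra.leftMulMatrix quaternionBasis (Q a c) r s := rfl

lemma realification_star {n : ℕ} (Q : Matrix (Fin n) (Fin n) ℍ[ℝ]) :
    realification n (star Q) = (realification n Q)ᵀ := by
  ext ⟨a, r⟩ ⟨c, s⟩
  rw [Matrix.transpose_apply, realification_apply, realification_apply, Matrix.star_apply,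
    leftMulMatrix_quaternionBasis, leftMulMatrix_quaternionBasis]
  fin_cases r <;> fin_cases s <;> simp

lemma realification_injective (n : ℕ) : Function.Injective (realification n) := by
  intro Q Q' H
  ext1 a c
  refine Algebra.leftMulMatrix_injective quaternionBasis ?_
  ext r s
  exact congr_fun (congr_fun H (a, r)) (c, s)

lemma transpose_realification_mul_self_eq_one_iff {n : ℕ} (Q : Matrix (Fin n) (Fin n) ℍ[ℝ]) :
    (realification n Q)ᵀ * realification n Q = 1 ↔ Q ∈ CompactSp n := by
  have H₁ : (realification n Q)ᵀ * realification n Q = 1 ↔ star Q * Q = 1 := by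
    rw [← realification_star, ← map_mul, ← map_one (realification n),
      (realification_injective n).eq_iff]
  have H₂ : realification n Q * (realification n Q)ᵀ = 1 ↔ Q * star Q = 1 := by
    rw [← realification_star, ← map_mul, ← map_one (realification n),
      (realification_injective n).eq_iff]
  rw [Unitary.mem_iff, ← H₁, ← H₂, and_iff_left_of_imp mul_eq_one_comm.1]

/-- Left multiplication by a quaternionic matrix commutes with the right action of `ℍ`. -/
lemma IsContactTriple.sum_realification_smul {φ : Fin 3 → V →L[ℝ] V} {η : V →L[ℝ] ℝ} {ξ : V}
    (h : IsContactTriple φ η ξ) {n : ℕ} {e : Fin n → V} (he : ∀ a, η (e a) = 0)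
    (Q : Matrix (Fin n) (Fin n) ℍ[ℝ]) (c : Fin n) (s : Fin 4) :
    ∑ x : Fin n × Fin 4, realification n Q x (c, s) • quaternionUnitAction φ x.2 (e x.1) =
      quaternionUnitAction φ s
        (∑ x : Fin n × Fin 4, realification n Q x (c, 0) • quaternionUnitAction φ x.2 (e x.1)) := by
  simp only [Fintype.sum_prod_type, map_sum, realification_apply, leftMulMatrix_quaternionBasis]
  refine Finset.sum_congr rfl fun a _ ↦ ?_
  fin_cases s <;>
    simp [Fin.sum_univ_four, quaternionUnitAction, h.phi_phi, h.phi_one_two, h.phi_two_zero,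
      h.phi_zero_one, h.phi_one_zero, h.phi_two_one, h.phi_zero_two, he] <;>
    module

lemma Orthonormal.sum_smul_iff {ι : Type*} [Fintype ι] [DecidableEq ι] {f : ι → V}
    (hf : Orthonormal ℝ f) (A : Matrix ι ι ℝ) :
    Orthonormal ℝ (fun j ↦ ∑ i, A i j • f i) ↔ Aᵀ * A = 1 := by
  rw [orthonormal_iff_ite, ← Matrix.ext_iff]
  refine forall₂_congr fun i j ↦ ?_
  rw [hf.inner_sum]
  simp [Matrix.mul_apply, Matrix.one_apply]

/-- The frame `b · diag(Q, 1)` is `(e'_c, e'_c i, e'_c j, e'_c k, ξ)`, for any quaternionic matrix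
`Q` and any frame `b` of that form. -/
lemma IsContactTriple.sum_fromBlocks_smul {φ : Fin 3 → V →L[ℝ] V} {η : V →L[ℝ] ℝ} {ξ : V}
    (h : IsContactTriple φ η ξ) {n : ℕ} {e : Fin n → V} (he : ∀ a, η (e a) = 0)
    (Q : Matrix (Fin n) (Fin n) ℍ[ℝ]) :
    (fun j ↦ ∑ i, Matrix.fromBlocks (realification n Q) 0 0 (1 : Matrix Unit Unit ℝ) i j •
        quaternionFrame φ ξ e i) =
      quaternionFrame φ ξ fun c ↦
        ∑ x : Fin n × Fin 4, realification n Q x (c, 0) • quaternionUnitAction φ x.2 (e x.1) := by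
  funext j
  rcases j with ⟨c, s⟩ | t
  · simp only [Fintype.sum_sum_type, quaternionFrame_inl, ← h.sum_realification_smul he Q c s]
    simp only [Matrix.fromBlocks_apply₁₁, Matrix.fromBlocks_apply₂₁, Matrix.zero_apply, zero_smul,
      Finset.sum_const_zero, add_zero]
    rfl
  · simp [Fintype.sum_sum_type]

/-- The adapted frames are an orbit of `Sp(n) × I`. -/
lemma IsContactTriple.isAdaptedFrame_iff {φ : Fin 3 → V →L[ℝ] V} {η : V →L[ℝ] ℝ} {ξ : V}
    (h : IsContactTriple φ η ξ) {n : ℕ} {b b' : Module.Basis (FrameIndex n) ℝ V}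
    (hb : IsAdaptedFrame φ ξ b) :
    IsAdaptedFrame φ ξ b' ↔ ∃ A ∈ spTimesOne n,
      ∀ j, b' j = ∑ i, (A : Matrix (FrameIndex n) (FrameIndex n) ℝ) i j • b i := by
  obtain ⟨hbo, hbq⟩ := hb
  set e : Fin n → V := fun a ↦ b (Sum.inl (a, 0)) with he_def
  have he : ∀ a, η (e a) = 0 := h.eta_eq_zero_of_orthonormal (by rwa [← hbq])
  constructor
  · rintro ⟨hbo', hbq'⟩
    set e' : Fin n → V := fun a ↦ b' (Sum.inl (a, 0)) with he'_def
    have he' : ∀ a, η (e' a) = 0 := h.eta_eq_zero_of_orthonormal (by rwa [← hbq'])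
    -- the entries of `Q` are the quaternionic coordinates of the vectors `e'_c`
    let Q : Matrix (Fin n) (Fin n) ℍ[ℝ] := fun a c ↦
      ⟨inner ℝ (b (Sum.inl (a, 0))) (e' c), inner ℝ (b (Sum.inl (a, 1))) (e' c),
        inner ℝ (b (Sum.inl (a, 2))) (e' c), inner ℝ (b (Sum.inl (a, 3))) (e' c)⟩
    have hQ (a c : Fin n) (r : Fin 4) :
        realification n Q (a, r) (c, 0) = inner ℝ (b (Sum.inl (a, r))) (e' c) := by
      rw [realification_apply, leftMulMatrix_quaternionBasis]
      fin_cases r <;> rfl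
    have hsum (c : Fin n) : e' c =
        ∑ x : Fin n × Fin 4, realification n Q x (c, 0) • quaternionUnitAction φ x.2 (e x.1) := by
      have hη : inner ℝ (b (Sum.inr ())) (e' c) = (0 : ℝ) := by
        rw [hbq, quaternionFrame_inr, real_inner_comm, h.inner_xi, he']
      have := (b.toOrthonormalBasis hbo).sum_repr' (e' c)
      simp only [Fintype.sum_sum_type, Module.Basis.coe_toOrthonormalBasis, Finset.univ_unique,
        Finset.sum_singleton, hη, zero_smul, add_zero, PUnit.default_eq_unit] at this
      rw [← this]
      refine Finset.sum_congr rfl fun x _ ↦ ?_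
      obtain ⟨a, r⟩ := x
      rw [hQ]
      congr 1
      exact congr_fun hbq (Sum.inl (a, r))
    have hb' : (b' : FrameIndex n → V) = fun j ↦ ∑ i, Matrix.fromBlocks (realification n Q) 0 0
        (1 : Matrix Unit Unit ℝ) i j • b i := by
      rw [hbq, h.sum_fromBlocks_smul he, hbq']
      congr 1
      exact funext hsum
    have hA := (hbo.sum_smul_iff _).1 (hb' ▸ hbo')
    have hQu : Q ∈ CompactSp n := by
      rw [← transpose_realification_mul_self_eq_one_iff]
      simpa [Matrix.fromBlocks_transpose, Matrix.fromBlocks_multiply,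
        ← Matrix.fromBlocks_one, Matrix.fromBlocks_inj] using hA
    exact ⟨spTimesOneHom n ⟨Q, hQu⟩, ⟨_, rfl⟩, fun j ↦ congr_fun hb' j⟩
  · rintro ⟨_, ⟨Q, rfl⟩, hQ⟩
    have hb' : (b' : FrameIndex n → V) = fun j ↦ ∑ i, Matrix.fromBlocks (realification n Q) 0 0
        (1 : Matrix Unit Unit ℝ) i j • b i := funext hQ
    have hQu := (transpose_realification_mul_self_eq_one_iff _).2 Q.2
    have hbo' : Orthonormal ℝ b' := by
      rw [hb', hbo.sum_smul_iff, Matrix.fromBlocks_transpose, Matrix.fromBlocks_multiply]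
      simp [hQu]
    rw [hbq, h.sum_fromBlocks_smul he] at hb'
    rw [hb'] at hbo' ⊢
    exact isAdaptedFrame_quaternionFrame hbo'

end LinearAlgebra

/-! ### Smooth adapted frames -/

section Manifolds

lemma finiteDimensional_tangentSpace {m : ℕ} {M : Type*} [TopologicalSpace M]
    [ChartedSpace (EuclideanSpace ℝ (Fin m)) M] (p : M) :
    FiniteDimensional ℝ (TangentSpace (𝓡 m) p) :=
  inferInstanceAs (FiniteDimensional ℝ (EuclideanSpace ℝ (Fin m)))

lemma finrank_tangentSpace {m : ℕ} {M : Type*} [TopologicalSpace M]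
    [ChartedSpace (EuclideanSpace ℝ (Fin m)) M] (p : M) :
    Module.finrank ℝ (TangentSpace (𝓡 m) p) = m :=
  finrank_euclideanSpace_fin (𝕜 := ℝ) (n := m)

variable {m : ℕ} {M : Type*} [TopologicalSpace M] [ChartedSpace (EuclideanSpace ℝ (Fin m)) M]
  [IsManifold (𝓡 m) ∞ M] [RiemannianBundle (fun p : M ↦ TangentSpace (𝓡 m) p)]
  [IsContMDiffRiemannianBundle (𝓡 m) ∞ (EuclideanSpace ℝ (Fin m))
    (fun p : M ↦ TangentSpace (𝓡 m) p)]
  {φ : Fin 3 → (p : M) → TangentSpace (𝓡 m) p →L[ℝ] TangentSpace (𝓡 m) p}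
  {η : (p : M) → TangentSpace (𝓡 m) p →L[ℝ] ℝ} {ξ : (p : M) → TangentSpace (𝓡 m) p}

lemma IsThreeKenmotsu.isContactTriple (h : IsThreeKenmotsu φ η ξ) (p : M) :
    IsContactTriple (fun α ↦ φ α p) (η p) (ξ p) where
  phi_phi α := (h.kenmotsu α).phi_phi p
  eta_xi := (h.kenmotsu 0).eta_xi p
  eta_phi α := (h.kenmotsu α).eta_phi p
  phi_xi α := (h.kenmotsu α).phi_xi p
  inner_phi_phi α := (h.kenmotsu α).inner_phi_phi p
  phi_one_two v := (h.phi_comp (finRotate 3) (by decide) p v).symm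
  phi_two_zero v := (h.phi_comp (finRotate 3 ^ 2) (by decide) p v).symm
  phi_zero_one v := (h.phi_comp 1 (by decide) p v).symm

lemma IsThreeKenmotsu.contMDiffOn_quaternionFrame (h : IsThreeKenmotsu φ η ξ) {k : ℕ}
    {e : Fin k → (x : M) → TangentSpace (𝓡 m) x} {u : Set M}
    (he : ∀ a, ContMDiffOn (𝓡 m) (𝓡 m).tangent ∞
      (fun x ↦ (⟨x, e a x⟩ : TangentBundle (𝓡 m) M)) u) (i : FrameIndex k) :
    ContMDiffOn (𝓡 m) (𝓡 m).tangent ∞ (fun x ↦ (⟨x, quaternionFrame (fun α ↦ φ α x) (ξ x)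
      (e · x) i⟩ : TangentBundle (𝓡 m) M)) u := by
  rcases i with ⟨a, s⟩ | -
  · have hφ (α : Fin 3) : ContMDiffOn (𝓡 m) (𝓡 m).tangent ∞
        (fun x ↦ (⟨x, φ α x (e a x)⟩ : TangentBundle (𝓡 m) M)) u :=
      ContMDiffOn.clm_bundle_apply (h.kenmotsu α).smooth_phi.contMDiffOn (he a)
    fin_cases s
    exacts [he a, hφ 1, hφ 0, hφ 2]
  · exact (h.kenmotsu 0).smooth_xi.contMDiffOn

/-- Near every point there are `k` smooth fields `e_a` such that all `e_a, e_a i, e_a j, e_a k` and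
`ξ` together are orthonormal. By induction on `k`: a tangent vector orthogonal to the given
family is extended to a smooth field, which is projected to the orthogonal complement of the family and
normalized. The hypothesis on `k` only makes the family of the preceding step too short to span; as
the conclusion implies `4 * k + 1 ≤ m`, the lemma also shows that `m` is `1` modulo `4`. -/
lemma IsThreeKenmotsu.exists_smooth_quaternionFrame (h : IsThreeKenmotsu φ η ξ) (p : M) (k : ℕ)
    (hk : 4 * k ≤ m + 2) :
    ∃ (u : Set M) (e : Fin k → (x : M) → TangentSpace (𝓡 m) x), IsOpen u ∧ p ∈ u ∧
      (∀ a, ContMDiffOn (𝓡 m) (𝓡 m).tangent ∞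
        (fun x ↦ (⟨x, e a x⟩ : TangentBundle (𝓡 m) M)) u) ∧
      ∀ x ∈ u, Orthonormal ℝ (quaternionFrame (fun α ↦ φ α x) (ξ x) (e · x)) := by
  induction k with
  | zero =>
    refine ⟨Set.univ, finZeroElim, isOpen_univ, Set.mem_univ _, finZeroElim, fun x _ ↦ ?_⟩
    exact (h.isContactTriple x).orthonormal_quaternionFrame finZeroElim finZeroElim finZeroElim
  | succ k ih =>
    obtain ⟨u, e, hu, hpu, hes, heo⟩ := ih (by omega)
    have := finiteDimensional_tangentSpace (m := m) p
    obtain ⟨v, hv0, hv⟩ := (heo p hpu).exists_ne_zero_forall_inner_eq_zero (by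
      rw [finrank_tangentSpace]
      simp only [Fintype.card_sum, Fintype.card_prod, Fintype.card_fin, Fintype.card_unit]
      omega)
    set f : FrameIndex k → (x : M) → TangentSpace (𝓡 m) x :=
      fun i x ↦ quaternionFrame (fun α ↦ φ α x) (ξ x) (e · x) i with hf
    have hfs := h.contMDiffOn_quaternionFrame hes
    obtain ⟨t, ht, hXs⟩ := FiberBundle.exists_contMDiffOn_extend (𝓡 m)
      (EuclideanSpace ℝ (Fin m)) (k := ∞) v
    obtain ⟨t', ht't, ht', hpt'⟩ := mem_nhds_iff.1 ht
    set X := FiberBundle.extend (EuclideanSpace ℝ (Fin m)) v with hX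
    have hXp : X p = v := FiberBundle.extend_apply_self _ v
    set W : (x : M) → TangentSpace (𝓡 m) x :=
      fun x ↦ X x - ∑ i, (inner ℝ (f i x) (X x) : ℝ) • f i x with hW
    have hWs : ContMDiffOn (𝓡 m) (𝓡 m).tangent ∞
        (fun x ↦ (⟨x, W x⟩ : TangentBundle (𝓡 m) M)) (u ∩ t') := by
      have hX' := hXs.mono (Set.inter_subset_right.trans ht't : u ∩ t' ⊆ t)
      have hf' (i) := (hfs i).mono (Set.inter_subset_left : u ∩ t' ⊆ u)
      refine ContMDiffOn.sub_section hX' (ContMDiffOn.sum_section fun i _ ↦ ?_)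
      exact ContMDiffOn.smul_section ((hf' i).inner_bundle hX') (hf' i)
    have hWW := hWs.inner_bundle hWs
    set w : Set M := (u ∩ t') ∩ (fun x ↦ (inner ℝ (W x) (W x) : ℝ)) ⁻¹' {0}ᶜ with hw
    have hwo : IsOpen w :=
      hWW.continuousOn.isOpen_inter_preimage (hu.inter ht') isOpen_compl_singleton
    have hWp : W p = v := by
      simp only [hW, hXp]
      rw [Finset.sum_eq_zero, sub_zero]
      intro i _
      rw [hv i, zero_smul]
    set N : (x : M) → TangentSpace (𝓡 m) x :=
      fun x ↦ (√(inner ℝ (W x) (W x)))⁻¹ • W x with hN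
    have hNs : ContMDiffOn (𝓡 m) (𝓡 m).tangent ∞
        (fun x ↦ (⟨x, N x⟩ : TangentBundle (𝓡 m) M)) w := by
      refine ContMDiffOn.smul_section (f := fun x ↦ (√(inner ℝ (W x) (W x)))⁻¹) (s := W)
        (fun x hx ↦ ?_) (hWs.mono Set.inter_subset_left)
      have hx0 : (inner ℝ (W x) (W x) : ℝ) ≠ 0 := hx.2
      have hsqrt : ContDiffAt ℝ ∞ (fun r : ℝ ↦ (√r)⁻¹) (inner ℝ (W x) (W x)) :=
        (Real.contDiffAt_sqrt hx0).inv
          (Real.sqrt_ne_zero'.2 (real_inner_self_nonneg.lt_of_ne' hx0))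
      exact hsqrt.contMDiffAt.comp_contMDiffWithinAt (f := fun x ↦ (inner ℝ (W x) (W x) : ℝ)) x
        ((hWW x hx.1).mono Set.inter_subset_left)
    have hwu : w ⊆ u := Set.inter_subset_left.trans Set.inter_subset_left
    refine ⟨w, Fin.cons N e, hwo, ⟨⟨hpu, hpt'⟩, ?_⟩, Fin.cases hNs fun a ↦ (hes a).mono hwu,
      fun x hx ↦ ?_⟩
    · simpa [hWp] using hv0
    · have hx0 : (inner ℝ (W x) (W x) : ℝ) ≠ 0 := hx.2
      have hcons : (fun a : Fin (k + 1) ↦ (Fin.cons N e : Fin (k + 1) → _) a x) =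
          Fin.cons (N x) (e · x) := by
        funext a
        exact Fin.cases rfl (fun _ ↦ rfl) a
      rw [hcons]
      refine (h.isContactTriple x).orthonormal_quaternionFrame_cons (heo x hx.1.1) ?_ fun i ↦ ?_
      · rw [hN, real_inner_smul_left, real_inner_smul_right, ← mul_assoc, ← mul_inv,
          Real.mul_self_sqrt real_inner_self_nonneg, inv_mul_cancel₀ hx0]
      · rw [hN, real_inner_smul_right]
        have := (heo x hx.1.1).inner_sub_sum_eq_zero (X x) i
        exact mul_eq_zero_of_right _ this

lemma IsThreeKenmotsu.exists_isLocalFrameOn (h : IsThreeKenmotsu φ η ξ) {n : ℕ}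
    (hm : m = 4 * n + 1) (p : M) :
    ∃ (u : Set M) (s : FrameIndex n → (x : M) → TangentSpace (𝓡 m) x)
      (hs : IsLocalFrameOn (𝓡 m) (EuclideanSpace ℝ (Fin m)) ∞ s u), IsOpen u ∧ p ∈ u ∧
      ∀ x (hx : x ∈ u), IsAdaptedFrame (fun α ↦ φ α x) (ξ x) (hs.toBasisAt hx) := by
  obtain ⟨u, e, hu, hpu, hes, heo⟩ := h.exists_smooth_quaternionFrame p n (by omega)
  have hs : IsLocalFrameOn (𝓡 m) (EuclideanSpace ℝ (Fin m)) ∞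
      (fun i x ↦ quaternionFrame (fun α ↦ φ α x) (ξ x) (e · x) i) u :=
    { linearIndependent := fun hx ↦ (heo _ hx).linearIndependent
      generating := fun {x} hx ↦ by
        have := finiteDimensional_tangentSpace (m := m) x
        refine ((heo x hx).linearIndependent.span_eq_top_of_card_eq_finrank' ?_).ge
        rw [finrank_tangentSpace, hm]
        simp [mul_comm]
      contMDiffOn := h.contMDiffOn_quaternionFrame hes }
  refine ⟨u, _, hs, hu, hpu, fun x hx ↦ ?_⟩
  have hb : (hs.toBasisAt hx : FrameIndex n → TangentSpace (𝓡 m) x) =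
      quaternionFrame (fun α ↦ φ α x) (ξ x) (e · x) := funext fun i ↦ hs.toBasisAt_coe hx i
  rw [hb]
  exact isAdaptedFrame_quaternionFrame (heo x hx)

lemma IsThreeKenmotsu.exists_dim_eq [Nonempty M] (h : IsThreeKenmotsu φ η ξ) :
    ∃ n : ℕ, m = 4 * n + 1 := by
  obtain ⟨p⟩ := ‹Nonempty M›
  -- the largest `k` allowed by `exists_smooth_quaternionFrame`, so that `m ≤ 4 * k + 1`
  obtain ⟨u, e, -, hpu, -, heo⟩ := h.exists_smooth_quaternionFrame p ((m + 2) / 4) (by omega)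
  have := finiteDimensional_tangentSpace (m := m) p
  have hcard := (heo p hpu).linearIndependent.fintype_card_le_finrank
  rw [finrank_tangentSpace] at hcard
  simp only [Fintype.card_sum, Fintype.card_prod, Fintype.card_fin, Fintype.card_unit] at hcard
  exact ⟨(m + 2) / 4, by omega⟩

/-- The adapted frames form a principal subbundle with group `Sp(n) × I`. -/
def IsThreeKenmotsu.structureGroupReduction (h : IsThreeKenmotsu φ η ξ) {n : ℕ}
    (hm : m = 4 * n + 1) : StructureGroupReduction m M (spTimesOne n) where
  frames p := {b | IsAdaptedFrame (fun α ↦ φ α p) (ξ p) b}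
  mem_frames_iff p _ hb _ := (h.isContactTriple p).isAdaptedFrame_iff hb
  exists_localFrame := h.exists_isLocalFrameOn hm

end Manifolds

theorem mainTheorem6 {m : ℕ} (M : Type*) [TopologicalSpace M] [T2Space M]
    [SecondCountableTopology M] [Nonempty M]
    [ChartedSpace (EuclideanSpace ℝ (Fin m)) M] [IsManifold (𝓡 m) ∞ M]
    [RiemannianBundle (fun p : M ↦ TangentSpace (𝓡 m) p)]
    [IsContMDiffRiemannianBundle (𝓡 m) ∞ (EuclideanSpace ℝ (Fin m))
      (fun p : M ↦ TangentSpace (𝓡 m) p)]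
    (φ : Fin 3 → (p : M) → TangentSpace (𝓡 m) p →L[ℝ] TangentSpace (𝓡 m) p)
    (η : (p : M) → TangentSpace (𝓡 m) p →L[ℝ] ℝ)
    (ξ : (p : M) → TangentSpace (𝓡 m) p)
    (h : IsThreeKenmotsu φ η ξ) :
    ∃ n : ℕ, m = 4 * n + 1 ∧ Nonempty (StructureGroupReduction m M (spTimesOne n)) := by
  obtain ⟨n, hn⟩ := h.exists_dim_eq
  exact ⟨n, hn, ⟨h.structureGroupReduction hn⟩⟩
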